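/- Conventions. A Hadamard space is a complete geodesic metric space $(X,d)$ such that, for every constant-speed geodesic $\gamma:[0,1]\to X$, every $z\in X$ and every $t\in[0,1]$, $d(z,\gamma(t))^2\le(1-t)\,d(z,\gamma(0))^2+t\,d(z,\gamma(1))^2-t(1-t)\,d(\gamma(0),\gamma(1))^2$. Geodesics are then unique, and $(1-t)x+ty$ denotes the point $\gamma(t)$ of the geodesic from $x$ to $y$. A CAT(0) cubical complex is a Hadamard space $X$ that is a union of distinguished subsets (cells), each identified isometrically with a unit cube $[0,1]^n$ ($n$ depending on the cell) in an ambient Euclidean space $\mathbf E=\mathbb R^n$, such that each face of a cell is a cell, any two cells are disjoint or meet in a common face, and $d$ is the intrinsic metric: $d(x,y)$ is the infimum of $\sum_{i<m}d(p_i,p_{i+1})$ over finite strings $x=p_0,\dots,p_m=y$ whose consecutive points lie in a common cell. A cell is maximal if no other cell contains it. For a nonempty finite set $A\subset X$ let $\Delta^A=\{w\in\mathbb R^A: w\ge 0,\ \sum_a w_a=1\}$. A vector $w$ certifies $x\in\mathrm{mean}(A)$ if $w\in\Delta^A$ and $x$ minimizes $\sum_a w_a d(a,\cdot)^2$ over $X$;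 $\mathrm{mean}(A)$ is the set of points $x$ for which such a $w$ exists. A point $y$ certifies $x\notin\mathrm{mean}(A)$ if $d(a,y)<d(a,x)$ for all $a\in A$. For $x\notin A$ the mean deficit is $$\mathrm{def}_A(x)=\Big(\sup_{y\ne x}\ \min_{a\in A}\ d(a,x)\cos\angle axy\Big)^+,$$ where $\angle axy$ is the Alexandrov angle at $x$ between the geodesics from $x$ to $a$ and from $x$ to $y$. Theorem. Let $X$ be a CAT(0) cubical complex, $A\subset X$ a nonempty finite set, and $\bar x\notin A$ a point in the relative interior of a maximal cell $C$ with ambient Euclidean space $\mathbf E$. For each $a\in A$, the point $x_a=(1-t_a)\bar x+t_a a$ lies in $C$ for all sufficiently small $t_a\in(0,1]$. Given any values $t_a\in(0,1]$ with $x_a\in C$ ($a\in A$), put $z_a=\bar x+\frac1{t_a}(x_a-\bar x)\in\mathbf E$. Then $$\mathrm{def}_A(\bar x)=\min\Big\{|z-\bar x| : z=\sum_{a\in A}w_a z_a,\ z\in\mathbf E,\ w\in\Delta^A\Big\},$$ and the minimum is attained. Let $(\hat z,\hat w)\in\mathbf E\times\Delta^A$ be any pair attaining the minimum. If $\mathrm{def}_A(\bar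 x)=0$, then $\bar x\in\mathrm{mean}(A)$, and this is certified by $\hat w$. If $\mathrm{def}_A(\bar x)>0$, then $\bar x\notin\mathrm{mean}(A)$, and for all sufficiently small $t>0$ the point $(1-t)\bar x+t\hat z$ of $\mathbf E$ lies in $C$ and certifies this. -/

import Mathlib

open scoped Topology

noncomputable section

namespace CubeMean

/-! ### Hadamard spaces -/

/-- `γ`, restricted to `[0,1]`, is a constant-speed geodesic from `x` to `y`. -/
structure IsGeodesic {X : Type*} [MetricSpace X] (γ : ℝ → X) (x y : X) : Prop where
  source : γ 0 = x
  target : γ 1 = y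
  dist_eq : ∀ s ∈ Set.Icc (0 : ℝ) 1, ∀ t ∈ Set.Icc (0 : ℝ) 1,
    dist (γ s) (γ t) = |s - t| * dist x y

/-- A Hadamard space: a complete geodesic space satisfying the CAT(0) inequality. -/
class HadamardSpace (X : Type*) [MetricSpace X] : Prop where
  complete : CompleteSpace X
  exists_geodesic : ∀ x y : X, ∃ γ : ℝ → X, IsGeodesic γ x y
  cat_zero : ∀ (x y : X) (γ : ℝ → X), IsGeodesic γ x y → ∀ z : X, ∀ t ∈ Set.Icc (0 : ℝ) 1,
    dist z (γ t) ^ 2 ≤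
      (1 - t) * dist z x ^ 2 + t * dist z y ^ 2 - t * (1 - t) * dist x y ^ 2

/-- The point `(1 - t) x + t y` on the geodesic from `x` to `y`, for `t ∈ [0,1]`. -/
def geoPoint {X : Type*} [MetricSpace X] [HadamardSpace X] (x y : X) (t : ℝ) : X :=
  Classical.choose (HadamardSpace.exists_geodesic x y) t

/-- `geoPoint x y` is a geodesic from `x` to `y`. -/
theorem isGeodesic_geoPoint {X : Type*} [MetricSpace X] [HadamardSpace X] (x y : X) :
    IsGeodesic (geoPoint x y) x y :=
  Classical.choose_spec (HadamardSpace.exists_geodesic x y)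

/-- Geodesics in a Hadamard space are unique, so `geoPoint` does not depend on a choice. -/
theorem IsGeodesic.eq_geoPoint {X : Type*} [MetricSpace X] [HadamardSpace X] {x y : X}
    {γ : ℝ → X} (h : IsGeodesic γ x y) {t : ℝ} (ht : t ∈ Set.Icc (0 : ℝ) 1) :
    γ t = geoPoint x y t := by
  have h0 : (0 : ℝ) ∈ Set.Icc (0 : ℝ) 1 := by simp
  have h1 : (1 : ℝ) ∈ Set.Icc (0 : ℝ) 1 := by simp
  have e0 : dist (γ t) x = t * dist x y := by
    have := h.dist_eq t ht 0 h0
    rwa [h.source, sub_zero, abs_of_nonneg ht.1] at this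
  have e1 : dist (γ t) y = (1 - t) * dist x y := by
    have := h.dist_eq t ht 1 h1
    rwa [h.target, abs_sub_comm, abs_of_nonneg (sub_nonneg.2 ht.2)] at this
  have key := HadamardSpace.cat_zero x y _ (isGeodesic_geoPoint x y) (γ t) t ht
  rw [e0, e1] at key
  have : dist (γ t) (geoPoint x y t) ^ 2 ≤ 0 := by nlinarith
  exact dist_eq_zero.1 (pow_eq_zero_iff two_ne_zero |>.1 (le_antisymm this (sq_nonneg _)))

/-- The Euclidean comparison angle at `x` for the points `y`, `z` (both different from `x`). -/
def comparisonAngle {X : Type*} [MetricSpace X] (x y z : X) : ℝ :=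
  Real.arccos ((dist x y ^ 2 + dist x z ^ 2 - dist y z ^ 2) / (2 * dist x y * dist x z))

/-- The Alexandrov angle at `x` between the geodesics from `x` to `y` and from `x` to `z`
(for `y`, `z` different from `x`). -/
def alexandrovAngle {X : Type*} [MetricSpace X] [HadamardSpace X] (x y z : X) : ℝ :=
  Filter.limsup
    (fun p : ℝ × ℝ => comparisonAngle x (geoPoint x y p.1) (geoPoint x z p.2))
    (𝓝[>] (0 : ℝ) ×ˢ 𝓝[>] (0 : ℝ))

/-! ### The mean set, certificates and the mean deficit -/

/-- The weight vector `w` certifies `x ∈ mean(A)`: it lies in the simplex, and `x` minimizes the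
weighted sum of squared distances to the points of `A`. -/
def CertifiesMean {X : Type*} [MetricSpace X] (A : Finset X) (w : A → ℝ) (x : X) : Prop :=
  w ∈ stdSimplex ℝ A ∧
    ∀ y : X, ∑ a : A, w a * dist (a : X) x ^ 2 ≤ ∑ a : A, w a * dist (a : X) y ^ 2

/-- The mean set: all barycenters of `A`. -/
def meanSet {X : Type*} [MetricSpace X] (A : Finset X) : Set X :=
  {x | ∃ w : A → ℝ, CertifiesMean A w x}

/-- The point `y` certifies that `x` is outside the mean set: `y` is strictly closer than `x` to
every point of `A`. -/
def CertifiesNotMean {X : Type*} [MetricSpace X] (A : Finset X) (y x : X) : Prop :=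
  ∀ a ∈ A, dist a y < dist a x

/-- The mean deficit of the nonempty finite set `A` at a point `x ∉ A`. -/
def meanDeficit {X : Type*} [MetricSpace X] [HadamardSpace X]
    (A : Finset X) (hA : A.Nonempty) (x : X) : ℝ :=
  max (sSup {r : ℝ | ∃ y : X, y ≠ x ∧
    r = A.inf' hA (fun a => dist a x * Real.cos (alexandrovAngle x a y))}) 0

/-! ### Cubical complexes -/

/-- The cube `[0,1]^n` in Euclidean space. -/
def unitCube (n : ℕ) : Set (EuclideanSpace ℝ (Fin n)) :=
  {u | ∀ i, u i ∈ Set.Icc (0 : ℝ) 1}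

/-- The (nonempty) faces of `[0,1]^n`: some coordinates are fixed at `0`, some others at `1`. -/
def IsCubeFace {n : ℕ} (F : Set (EuclideanSpace ℝ (Fin n))) : Prop :=
  ∃ S T : Set (Fin n), Disjoint S T ∧
    F = {u | u ∈ unitCube n ∧ (∀ i ∈ S, u i = 0) ∧ ∀ i ∈ T, u i = 1}

/-- The structure of a cubical complex on a metric space `X`. Only the values of `dim` and `chart`
at cells, and only the values of each chart on the unit cube, are meaningful. -/
structure CubicalComplex (X : Type*) [MetricSpace X] where
  /-- The cells. -/
  cells : Set (Set X)
  /-- The dimension of a cell. -/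
  dim : Set X → ℕ
  /-- The identification of the unit cube in the ambient Euclidean space of a cell with the cell. -/
  chart : (C : Set X) → EuclideanSpace ℝ (Fin (dim C)) → X
  iUnion_cells : ⋃₀ cells = Set.univ
  chart_image : ∀ C ∈ cells, chart C '' unitCube (dim C) = C
  chart_isometry : ∀ C ∈ cells, ∀ u ∈ unitCube (dim C), ∀ v ∈ unitCube (dim C),
    dist (chart C u) (chart C v) = dist u v
  /-- Faces of cells are cells. -/
  face_mem : ∀ C ∈ cells, ∀ F, IsCubeFace F → chart C '' F ∈ cells
  /-- Two cells that meet do so in a common face. -/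
  inter_face : ∀ C ∈ cells, ∀ D ∈ cells, (C ∩ D).Nonempty →
    (∃ F, IsCubeFace F ∧ C ∩ D = chart C '' F) ∧ (∃ F, IsCubeFace F ∧ C ∩ D = chart D '' F)
  /-- The metric is the intrinsic metric induced by the Euclidean metrics of the cells: the distance
  between two points is the infimum of the lengths of the finite strings of points that join them
  and in which consecutive points share a cell. -/
  dist_isGLB : ∀ x y : X, IsGLB
    {L : ℝ | ∃ (m : ℕ) (p : ℕ → X), p 0 = x ∧ p m = y ∧
      (∀ i < m, ∃ C ∈ cells, p i ∈ C ∧ p (i + 1) ∈ C) ∧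
      L = ∑ i ∈ Finset.range m, dist (p i) (p (i + 1))}
    (dist x y)

/-- The pairs `(z, w)` of a weight vector `w` in the simplex and the corresponding convex
combination `z` of the points `z_a`. -/
def convexPairs {ι E : Type*} [Fintype ι] [AddCommGroup E] [Module ℝ E] (z : ι → E) :
    Set (E × (ι → ℝ)) :=
  {q | q.2 ∈ stdSimplex ℝ ι ∧ q.1 = ∑ i, q.2 i • z i}

end CubeMean

end

namespace CubeMean

open Filter Set

local notation "⟪" a ", " b "⟫" => inner ℝ a b

/-! ### The cube -/

/-! Around an interior point x of a maximal cell C the space is Euclidean: no other cell contains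
such a point, so short strings starting at x stay in C, and C contains a ball about x
(`exists_chart_eq_of_dist_lt`). Every geodesic from x to a point y therefore starts as a segment of
C, with an initial vector e_y of length d(x, y); for y = a this vector is z_a - v. Angles at x are
Euclidean angles between initial vectors (`cos_alexandrovAngle`), so the deficit is the positive
part of the supremum, over directions e, of min_a ⟨z_a - v, e⟩ / |e|.

Let m = zHat - v be a shortest convex combination of the vectors z_a - v. Averaging bounds the
supremum by |m|; the variational inequality |m|² ≤ ⟨z_a - v, m⟩ (`sq_norm_le_inner_of_isMinOn`)
shows that the direction m attains |m| if m ≠ 0.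

If m = 0, averaging the CAT(0) law of cosines `dist_sq_ge` with the weights kills the inner
products, and x is a minimizer. If m ≠ 0, the variational inequality makes a short move along m
approach every a at once (`dist_lt`). -/

theorem convex_unitCube (n : ℕ) : Convex ℝ (unitCube n) := by
  intro u hu w hw a b ha hb hab i
  exact convex_Icc (0 : ℝ) 1 (hu i) (hw i) ha hb hab

theorem coord_mem_Ioo_of_mem_interior {n : ℕ} {v : EuclideanSpace ℝ (Fin n)}
    (hv : v ∈ interior (unitCube n)) (i : Fin n) : v i ∈ Ioo (0 : ℝ) 1 := by
  obtain ⟨r, hr, hball⟩ := Metric.isOpen_iff.1 isOpen_interior v hv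
  have key : ∀ c : ℝ, |c| < r → v i + c ∈ Icc (0 : ℝ) 1 := by
    intro c hc
    have h := interior_subset (hball (show v + EuclideanSpace.single i c ∈ Metric.ball v r by
      simpa [mem_ball_iff_norm] using hc)) i
    simpa using h
  have h1 := key (r / 2) (by rw [abs_of_pos (by positivity)]; linarith)
  have h2 := key (-(r / 2)) (by rw [abs_neg, abs_of_pos (by positivity)]; linarith)
  exact ⟨by linarith [h2.1], by linarith [h1.2]⟩

theorem IsCubeFace.subset {n : ℕ} {F : Set (EuclideanSpace ℝ (Fin n))} (hF : IsCubeFace F) :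
    F ⊆ unitCube n := by
  obtain ⟨S, T, -, rfl⟩ := hF
  exact fun u hu => hu.1

theorem IsCubeFace.eq_unitCube {n : ℕ} {F : Set (EuclideanSpace ℝ (Fin n))} (hF : IsCubeFace F)
    {v : EuclideanSpace ℝ (Fin n)} (hv : v ∈ interior (unitCube n)) (hvF : v ∈ F) :
    F = unitCube n := by
  obtain ⟨S, T, -, rfl⟩ := hF
  refine Subset.antisymm (fun u hu => hu.1) fun u hu => ⟨hu, fun i hi => ?_, fun i hi => ?_⟩
  · exact absurd (hvF.2.1 i hi) (coord_mem_Ioo_of_mem_interior hv i).1.ne'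
  · exact absurd (hvF.2.2 i hi) (coord_mem_Ioo_of_mem_interior hv i).2.ne

theorem exists_pos_add_smul_mem {n : ℕ} {v : EuclideanSpace ℝ (Fin n)}
    (hv : v ∈ interior (unitCube n)) (e : EuclideanSpace ℝ (Fin n)) :
    ∃ δ : ℝ, 0 < δ ∧ ∀ s : ℝ, 0 ≤ s → s < δ → v + s • e ∈ unitCube n := by
  have hcont : Continuous fun s : ℝ => v + s • e := by fun_prop
  have h : (fun s : ℝ => v + s • e) ⁻¹' interior (unitCube n) ∈ 𝓝 (0 : ℝ) :=
    (isOpen_interior.preimage hcont).mem_nhds (by simpa using hv)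
  obtain ⟨δ, hδ, hb⟩ := Metric.mem_nhds_iff.1 h
  refine ⟨δ, hδ, fun s h0 hs => interior_subset (hb ?_)⟩
  simpa [abs_of_nonneg h0] using hs

/-! ### Neighbourhoods of interior points of maximal cells -/

section Complex

variable {X : Type*} [MetricSpace X]

theorem CubicalComplex.chart_injOn (K : CubicalComplex X) {C : Set X} (hC : C ∈ K.cells) :
    InjOn (K.chart C) (unitCube (K.dim C)) := by
  intro u hu w hw h
  rw [← dist_eq_zero, ← K.chart_isometry C hC u hu w hw, h, dist_self]

theorem CubicalComplex.chart_mem (K : CubicalComplex X) {C : Set X} (hC : C ∈ K.cells)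
    {u : EuclideanSpace ℝ (Fin (K.dim C))} (hu : u ∈ unitCube (K.dim C)) : K.chart C u ∈ C :=
  (K.chart_image C hC).subset (mem_image_of_mem _ hu)

/-- A proper face fixes some coordinate at 0 or 1, so the face of C shared with D, containing an
interior point, is all of C. Maximality of C does the rest. -/
theorem CubicalComplex.eq_of_chart_interior_mem (K : CubicalComplex X) {C D : Set X}
    (hC : Maximal (fun D => D ∈ K.cells) C) (hD : D ∈ K.cells)
    {u : EuclideanSpace ℝ (Fin (K.dim C))} (hu : u ∈ interior (unitCube (K.dim C)))
    (huD : K.chart C u ∈ D) : D = C := by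
  have huC := K.chart_mem hC.1 (interior_subset hu)
  obtain ⟨F, hF, hCD⟩ := (K.inter_face C hC.1 D hD ⟨_, huC, huD⟩).1
  obtain ⟨u', hu', he⟩ : K.chart C u ∈ K.chart C '' F := hCD ▸ ⟨huC, huD⟩
  obtain rfl := K.chart_injOn hC.1 (hF.subset hu') (interior_subset hu) he
  rw [hF.eq_unitCube hu hu', K.chart_image C hC.1] at hCD
  have hsub : C ⊆ D := fun y hy => (hCD.symm ▸ hy : y ∈ C ∩ D).2
  exact Subset.antisymm (hC.2 hD hsub) hsub

/-- A small ball about an interior point of a maximal cell lies in that cell. -/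
theorem CubicalComplex.exists_chart_eq_of_dist_lt (K : CubicalComplex X) {C : Set X}
    (hC : Maximal (fun D => D ∈ K.cells) C) {v : EuclideanSpace ℝ (Fin (K.dim C))} {r : ℝ}
    (hr : Metric.ball v r ⊆ interior (unitCube (K.dim C))) {y : X}
    (hy : dist (K.chart C v) y < r) :
    ∃ u ∈ unitCube (K.dim C), K.chart C u = y := by
  obtain ⟨L, ⟨m, p, hp0, hpm, hcell, rfl⟩, -, hL⟩ := (K.dist_isGLB (K.chart C v) y).exists_between hy
  have hmono : ∀ k ≤ m, ∑ i ∈ Finset.range k, dist (p i) (p (i + 1)) < r := fun k hk =>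
    (Finset.sum_le_sum_of_subset_of_nonneg (Finset.range_mono hk)
      fun _ _ _ => dist_nonneg).trans_lt hL
  -- The string cannot leave C: as long as its length is below r, the current point is interior to
  -- C, so the next cell of the string must be C itself.
  have key : ∀ k ≤ m, ∃ u ∈ unitCube (K.dim C), K.chart C u = p k ∧
      dist u v ≤ ∑ i ∈ Finset.range k, dist (p i) (p (i + 1)) := by
    intro k
    induction k with
    | zero =>
      intro _
      refine ⟨v, interior_subset (hr ?_), hp0.symm, by simp⟩
      exact Metric.mem_ball_self (dist_nonneg.trans_lt hy)
    | succ k ih =>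
      intro hk
      obtain ⟨u, hu, hup, hdist⟩ := ih (by omega)
      obtain ⟨D, hD, hkD, hk1D⟩ := hcell k (by omega)
      have hui : u ∈ interior (unitCube (K.dim C)) := hr (hdist.trans_lt (hmono k (by omega)))
      obtain rfl := K.eq_of_chart_interior_mem hC hD hui (hup ▸ hkD)
      rw [← K.chart_image D hD] at hk1D
      obtain ⟨u', hu', hup'⟩ := hk1D
      refine ⟨u', hu', hup', ?_⟩
      rw [Finset.sum_range_succ, ← hup, ← hup', K.chart_isometry D hD u hu u' hu']
      linarith [dist_triangle u' u v, dist_comm u u']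
  obtain ⟨u, hu, hup, -⟩ := key m le_rfl
  exact ⟨u, hu, hup.trans hpm⟩

/-- Points with a certificate of non-membership are not in the mean set. -/
theorem CertifiesNotMean.notMem_meanSet {A : Finset X} {x y : X} (h : CertifiesNotMean A y x) :
    x ∉ meanSet A := by
  rintro ⟨w, ⟨hw0, hw1⟩, hmin⟩
  refine (hmin y).not_gt (Finset.sum_lt_sum (fun a _ => ?_) ?_)
  · exact mul_le_mul_of_nonneg_left
      (pow_le_pow_left₀ dist_nonneg (h a a.2).le 2) (hw0 a)
  · by_contra! hcon
    have hzero : ∀ a : A, w a = 0 := fun a => by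
      refine le_antisymm (not_lt.1 fun hpos => ?_) (hw0 a)
      exact (hcon a (Finset.mem_univ _)).not_gt
        (mul_lt_mul_of_pos_left (pow_lt_pow_left₀ (h a a.2) dist_nonneg two_ne_zero) hpos)
    simp [hzero] at hw1

end Complex

/-! ### Initial vectors of geodesics -/

section Initial

variable {X : Type*} [MetricSpace X] [HadamardSpace X]

theorem geoPoint_zero (x y : X) : geoPoint x y 0 = x := (isGeodesic_geoPoint x y).source

theorem geoPoint_one (x y : X) : geoPoint x y 1 = y := (isGeodesic_geoPoint x y).target

theorem dist_geoPoint_left (x y : X) {t : ℝ} (ht : t ∈ Icc (0 : ℝ) 1) :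
    dist x (geoPoint x y t) = t * dist x y := by
  have := (isGeodesic_geoPoint x y).dist_eq 0 (by simp) t ht
  rwa [geoPoint_zero, zero_sub, abs_neg, abs_of_nonneg ht.1] at this

theorem dist_geoPoint_right (x y : X) {t : ℝ} (ht : t ∈ Icc (0 : ℝ) 1) :
    dist y (geoPoint x y t) = (1 - t) * dist x y := by
  have := (isGeodesic_geoPoint x y).dist_eq 1 (by simp) t ht
  rwa [geoPoint_one, abs_of_nonneg (sub_nonneg.2 ht.2)] at this

/-- The geodesic from the point `v` of the cell `C` to `y` starts, up to the parameter `τ`, as the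
segment with velocity `e`. -/
structure IsInitialVector (K : CubicalComplex X) (C : Set X)
    (v : EuclideanSpace ℝ (Fin (K.dim C))) (y : X) (e : EuclideanSpace ℝ (Fin (K.dim C)))
    (τ : ℝ) : Prop where
  pos : 0 < τ
  le_one : τ ≤ 1
  mem : ∀ s ∈ Icc 0 τ, v + s • e ∈ unitCube (K.dim C)
  geo : ∀ s ∈ Icc 0 τ, geoPoint (K.chart C v) y s = K.chart C (v + s • e)

variable {K : CubicalComplex X} {C : Set X} {v : EuclideanSpace ℝ (Fin (K.dim C))}

/-- Charts map segments to geodesics. -/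
theorem CubicalComplex.geoPoint_chart (K : CubicalComplex X) {C : Set X} (hC : C ∈ K.cells)
    {v u : EuclideanSpace ℝ (Fin (K.dim C))} (hv : v ∈ unitCube (K.dim C))
    (hu : u ∈ unitCube (K.dim C)) {s : ℝ} (hs : s ∈ Icc (0 : ℝ) 1) :
    geoPoint (K.chart C v) (K.chart C u) s = K.chart C (v + s • (u - v)) := by
  have hmem : ∀ s ∈ Icc (0 : ℝ) 1, v + s • (u - v) ∈ unitCube (K.dim C) := fun s hs =>
    (convex_unitCube _).add_smul_sub_mem hv hu hs
  have hgeo : IsGeodesic (fun s => K.chart C (v + s • (u - v))) (K.chart C v) (K.chart C u) := by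
    refine ⟨by simp, by simp, fun s hs t ht => ?_⟩
    rw [K.chart_isometry C hC _ (hmem s hs) _ (hmem t ht), K.chart_isometry C hC _ hv _ hu,
      dist_add_left, dist_eq_norm, ← sub_smul, norm_smul, Real.norm_eq_abs, dist_comm v u,
      dist_eq_norm]
  exact (hgeo.eq_geoPoint hs).symm

/-- The geodesic restricted to [0, t] and rescaled joins two points of the cell, so by uniqueness of
geodesics it is a segment. Applied to x_a, this gives the vector z_a - v. -/
theorem isInitialVector_of_geoPoint_eq (hC : C ∈ K.cells) (hv : v ∈ unitCube (K.dim C)) {y : X}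
    {t : ℝ} (ht : 0 < t) (ht1 : t ≤ 1) {u : EuclideanSpace ℝ (Fin (K.dim C))}
    (hu : u ∈ unitCube (K.dim C)) (hut : K.chart C u = geoPoint (K.chart C v) y t) :
    IsInitialVector K C v y ((1 / t) • (u - v)) t := by
  have hst : ∀ s ∈ Icc 0 t, s / t ∈ Icc (0 : ℝ) 1 := fun s hs =>
    ⟨div_nonneg hs.1 ht.le, (div_le_one ht).2 hs.2⟩
  have hsm : ∀ s : ℝ, s • (1 / t) • (u - v) = (s / t) • (u - v) := fun s => by
    rw [smul_smul, mul_one_div]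
  refine ⟨ht, ht1, fun s hs => ?_, fun s hs => ?_⟩
  · rw [hsm]
    exact (convex_unitCube _).add_smul_sub_mem hv hu (hst s hs)
  · rw [hsm, ← K.geoPoint_chart hC hv hu (hst s hs)]
    have hscale : ∀ σ ∈ Icc (0 : ℝ) 1, t * σ ∈ Icc (0 : ℝ) 1 := fun σ hσ =>
      ⟨mul_nonneg ht.le hσ.1, mul_le_one₀ ht1 hσ.1 hσ.2⟩
    have hgeo : IsGeodesic (fun σ => geoPoint (K.chart C v) y (t * σ)) (K.chart C v)
        (K.chart C u) := by
      refine ⟨by simp [geoPoint_zero], by simp [hut], fun a ha b hb => ?_⟩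
      rw [(isGeodesic_geoPoint (K.chart C v) y).dist_eq _ (hscale a ha) _ (hscale b hb), hut,
        dist_geoPoint_left _ _ ⟨ht.le, ht1⟩, ← mul_sub, abs_mul, abs_of_pos ht]
      ring
    rw [← hgeo.eq_geoPoint (hst s hs), mul_div_cancel₀ _ ht.ne']

theorem exists_chart_eq_geoPoint (hC : Maximal (fun D => D ∈ K.cells) C)
    (hv : v ∈ interior (unitCube (K.dim C))) (y : X) :
    ∃ δ : ℝ, 0 < δ ∧ ∀ t : ℝ, 0 < t → t ≤ 1 → t < δ →
      ∃ u ∈ unitCube (K.dim C), K.chart C u = geoPoint (K.chart C v) y t := by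
  obtain ⟨r, hr, hball⟩ := Metric.isOpen_iff.1 isOpen_interior v hv
  -- The `+ 1` keeps the denominator positive when y is the base point.
  refine ⟨r / (dist (K.chart C v) y + 1), by positivity, fun t h0 h1 ht => ?_⟩
  refine K.exists_chart_eq_of_dist_lt hC hball ?_
  rw [dist_geoPoint_left _ _ ⟨h0.le, h1⟩]
  rw [lt_div_iff₀ (by positivity)] at ht
  nlinarith

theorem exists_initialVector (hC : Maximal (fun D => D ∈ K.cells) C)
    (hv : v ∈ interior (unitCube (K.dim C))) (y : X) : ∃ e τ, IsInitialVector K C v y e τ := by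
  obtain ⟨δ, hδ, h⟩ := exists_chart_eq_geoPoint hC hv y
  have ht : 0 < min (δ / 2) 1 := by positivity
  obtain ⟨u, hu, hut⟩ := h _ ht (min_le_right _ _) ((min_le_left _ _).trans_lt (by linarith))
  exact ⟨_, _, isInitialVector_of_geoPoint_eq hC.1 (interior_subset hv) ht (min_le_right _ _) hu hut⟩

namespace IsInitialVector

variable {y y' : X} {e e' : EuclideanSpace ℝ (Fin (K.dim C))} {τ τ' : ℝ}

theorem dist_geo_geo (hC : C ∈ K.cells) (h : IsInitialVector K C v y e τ)
    (h' : IsInitialVector K C v y' e' τ') {s s' : ℝ} (hs : s ∈ Icc 0 τ) (hs' : s' ∈ Icc 0 τ') :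
    dist (geoPoint (K.chart C v) y s) (geoPoint (K.chart C v) y' s') = ‖s • e - s' • e'‖ := by
  rw [h.geo s hs, h'.geo s' hs', K.chart_isometry C hC _ (h.mem s hs) _ (h'.mem s' hs'),
    dist_add_left, dist_eq_norm]

theorem norm_eq (hC : C ∈ K.cells) (h : IsInitialVector K C v y e τ) :
    ‖e‖ = dist (K.chart C v) y := by
  have h1 := h.dist_geo_geo hC h ⟨h.pos.le, le_rfl⟩ ⟨le_rfl, h.pos.le⟩
  rw [geoPoint_zero, dist_comm, dist_geoPoint_left _ _ ⟨h.pos.le, h.le_one⟩, zero_smul, sub_zero,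
    norm_smul, Real.norm_of_nonneg h.pos.le] at h1
  exact (mul_left_cancel₀ h.pos.ne' h1).symm

theorem cos_alexandrovAngle (hC : C ∈ K.cells) (h : IsInitialVector K C v y e τ)
    (h' : IsInitialVector K C v y' e' τ') (hy : y ≠ K.chart C v) (hy' : y' ≠ K.chart C v) :
    Real.cos (alexandrovAngle (K.chart C v) y y') = ⟪e, e'⟫ / (‖e‖ * ‖e'‖) := by
  have he : 0 < ‖e‖ := by rw [h.norm_eq hC]; exact dist_pos.2 hy.symm
  have he' : 0 < ‖e'‖ := by rw [h'.norm_eq hC]; exact dist_pos.2 hy'.symm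
  -- For small parameters all three distances are Euclidean, so the comparison angle is constant and
  -- the limsup is that constant.
  have hev : ∀ᶠ p : ℝ × ℝ in 𝓝[>] (0 : ℝ) ×ˢ 𝓝[>] (0 : ℝ),
      comparisonAngle (K.chart C v) (geoPoint (K.chart C v) y p.1)
        (geoPoint (K.chart C v) y' p.2) = Real.arccos (⟪e, e'⟫ / (‖e‖ * ‖e'‖)) := by
    filter_upwards [prod_mem_prod (Ioc_mem_nhdsGT h.pos) (Ioc_mem_nhdsGT h'.pos)]
    rintro ⟨s, s'⟩ ⟨hs, hs'⟩
    have e1 := dist_geoPoint_left (K.chart C v) y ⟨hs.1.le, hs.2.trans h.le_one⟩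
    have e2 := dist_geoPoint_left (K.chart C v) y' ⟨hs'.1.le, hs'.2.trans h'.le_one⟩
    rw [← h.norm_eq hC] at e1
    rw [← h'.norm_eq hC] at e2
    have e3 := h.dist_geo_geo hC h' ⟨hs.1.le, hs.2⟩ ⟨hs'.1.le, hs'.2⟩
    have e4 := norm_sub_sq_real (s • e) (s' • e')
    rw [norm_smul, norm_smul, real_inner_smul_left, real_inner_smul_right,
      Real.norm_of_nonneg hs.1.le, Real.norm_of_nonneg hs'.1.le] at e4
    rw [comparisonAngle]
    simp only [e1, e2, e3, e4]
    congr 1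
    have := hs.1.ne'
    have := hs'.1.ne'
    field_simp
    ring
  have hlim : alexandrovAngle (K.chart C v) y y' = Real.arccos (⟪e, e'⟫ / (‖e‖ * ‖e'‖)) := by
    rw [alexandrovAngle, limsup_congr hev, limsup_const]
  rw [hlim]
  have habs := abs_le.1 (abs_real_inner_div_norm_mul_norm_le_one e e')
  exact Real.cos_arccos habs.1 habs.2

/-- The law of cosines in a Hadamard space, as an inequality. -/
theorem dist_sq_ge (hC : C ∈ K.cells) (h : IsInitialVector K C v y e τ)
    (h' : IsInitialVector K C v y' e' τ') :
    ‖e‖ ^ 2 + ‖e'‖ ^ 2 - 2 * ⟪e, e'⟫ ≤ dist y y' ^ 2 := by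
  have hτ : τ ∈ Icc (0 : ℝ) 1 := ⟨h.pos.le, h.le_one⟩
  have hτ' : τ' ∈ Icc (0 : ℝ) 1 := ⟨h'.pos.le, h'.le_one⟩
  -- CAT(0) is applied twice: along the geodesic to y' seen from y, then along the geodesic to y
  -- seen from the point at τ'. The distance between the two geodesic points is Euclidean.
  have c1 := HadamardSpace.cat_zero _ _ _ (isGeodesic_geoPoint (K.chart C v) y') y τ' hτ'
  have c2 := HadamardSpace.cat_zero _ _ _ (isGeodesic_geoPoint (K.chart C v) y)
    (geoPoint (K.chart C v) y' τ') τ hτ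
  rw [h'.dist_geo_geo hC h ⟨h'.pos.le, le_rfl⟩ ⟨h.pos.le, le_rfl⟩, norm_sub_sq_real, norm_smul,
    norm_smul, real_inner_smul_left, real_inner_smul_right, Real.norm_of_nonneg h.pos.le,
    Real.norm_of_nonneg h'.pos.le, dist_comm (geoPoint (K.chart C v) y' τ') (K.chart C v),
    dist_geoPoint_left _ _ hτ', ← h.norm_eq hC, ← h'.norm_eq hC,
    dist_comm (geoPoint (K.chart C v) y' τ') y, real_inner_comm] at c2
  rw [dist_comm y (K.chart C v), ← h.norm_eq hC, ← h'.norm_eq hC] at c1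
  have d2 : ‖e‖ ^ 2 + τ' ^ 2 * ‖e'‖ ^ 2 - 2 * τ' * ⟪e, e'⟫ ≤
      dist y (geoPoint (K.chart C v) y' τ') ^ 2 := by
    refine le_of_mul_le_mul_left ?_ h.pos
    linear_combination c2
  refine le_of_mul_le_mul_left ?_ h'.pos
  linear_combination c1 + d2

/-- A point of the cell in a direction that makes an acute angle with `e` is closer to `y`. -/
theorem dist_lt (hC : C ∈ K.cells) (h : IsInitialVector K C v y e τ)
    {m : EuclideanSpace ℝ (Fin (K.dim C))} (hm : m ≠ 0) (hem : ‖m‖ ^ 2 ≤ ⟪e, m⟫) {s : ℝ}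
    (hs : 0 < s) (hsτ : s < τ) (hmem : v + s • m ∈ unitCube (K.dim C)) :
    dist y (K.chart C (v + s • m)) < dist y (K.chart C v) := by
  have hτ : τ ∈ Icc (0 : ℝ) 1 := ⟨h.pos.le, h.le_one⟩
  have h1 : dist (geoPoint (K.chart C v) y τ) (K.chart C (v + s • m)) = ‖τ • e - s • m‖ := by
    rw [h.geo τ ⟨h.pos.le, le_rfl⟩, K.chart_isometry C hC _ (h.mem τ ⟨h.pos.le, le_rfl⟩) _ hmem,
      dist_add_left, dist_eq_norm]
  -- The Euclidean estimate is made against the point at parameter τ, still in the cell; the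
  -- triangle inequality then carries it to y.
  have h2 : ‖τ • e - s • m‖ < τ * ‖e‖ := by
    refine lt_of_pow_lt_pow_left₀ 2 (mul_nonneg h.pos.le (norm_nonneg _)) ?_
    rw [norm_sub_sq_real, norm_smul, norm_smul, real_inner_smul_left, real_inner_smul_right,
      Real.norm_of_nonneg h.pos.le, Real.norm_of_nonneg hs.le]
    have hm2 : 0 < ‖m‖ ^ 2 := by positivity
    have k1 : τ * (s * ‖m‖ ^ 2) ≤ τ * (s * ⟪e, m⟫) := by have := h.pos; gcongr
    have k2 : s * (s * ‖m‖ ^ 2) < τ * (s * ‖m‖ ^ 2) :=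
      mul_lt_mul_of_pos_right hsτ (mul_pos hs hm2)
    have k3 : 0 < s * (s * ‖m‖ ^ 2) := mul_pos hs (mul_pos hs hm2)
    linear_combination 2 * k1 + 2 * k2 + k3
  have h3 := dist_triangle y (geoPoint (K.chart C v) y τ) (K.chart C (v + s • m))
  rw [h1, dist_geoPoint_right _ _ hτ, ← h.norm_eq hC] at h3
  rw [dist_comm y (K.chart C v), ← h.norm_eq hC]
  linarith

end IsInitialVector

/-! ### Certificates of membership in the mean set -/

/-- In the weighted sum of the laws of cosines the inner products cancel, leaving the value at the
base point plus ‖e'‖². -/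
theorem certifiesMean_of_sum_eq_zero (hC : C ∈ K.cells) {A : Finset X}
    {e : A → EuclideanSpace ℝ (Fin (K.dim C))} {τ : A → ℝ}
    (he : ∀ a : A, IsInitialVector K C v (a : X) (e a) (τ a))
    (hex : ∀ y : X, ∃ e' τ', IsInitialVector K C v y e' τ')
    {w : A → ℝ} (hw : w ∈ stdSimplex ℝ A) (hsum : ∑ a, w a • e a = 0) :
    CertifiesMean A w (K.chart C v) := by
  refine ⟨hw, fun y => ?_⟩
  obtain ⟨e', τ', he'⟩ := hex y
  have h1 : ∑ a : A, w a * (‖e a‖ ^ 2 + ‖e'‖ ^ 2 - 2 * ⟪e a, e'⟫) ≤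
      ∑ a : A, w a * dist (a : X) y ^ 2 :=
    Finset.sum_le_sum fun a _ => mul_le_mul_of_nonneg_left ((he a).dist_sq_ge hC he') (hw.1 a)
  have h2 : ∑ a : A, w a * ⟪e a, e'⟫ = 0 := by
    have : ⟪∑ a, w a • e a, e'⟫ = 0 := by rw [hsum, inner_zero_left]
    simpa only [sum_inner, real_inner_smul_left] using this
  have h3 : ∑ a : A, w a * (‖e a‖ ^ 2 + ‖e'‖ ^ 2 - 2 * ⟪e a, e'⟫) =
      ∑ a : A, w a * ‖e a‖ ^ 2 + ‖e'‖ ^ 2 := by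
    have : ∀ a : A, w a * (‖e a‖ ^ 2 + ‖e'‖ ^ 2 - 2 * ⟪e a, e'⟫) =
        w a * ‖e a‖ ^ 2 + w a * ‖e'‖ ^ 2 - 2 * (w a * ⟪e a, e'⟫) := fun a => by ring
    simp_rw [this, Finset.sum_sub_distrib, Finset.sum_add_distrib, ← Finset.mul_sum,
      ← Finset.sum_mul, h2, hw.2]
    ring
  have h4 : ∀ a : A, dist (a : X) (K.chart C v) = ‖e a‖ := fun a => by
    rw [dist_comm, (he a).norm_eq hC]
  simp_rw [h4]
  linarith [sq_nonneg ‖e'‖]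

end Initial

/-! ### Shortest convex combinations -/

section Euclid

variable {ι E : Type*} [Fintype ι] [NormedAddCommGroup E] [InnerProductSpace ℝ E]

theorem isCompact_convexPairs (z : ι → E) : IsCompact (convexPairs z) := by
  have : convexPairs z = (fun w : ι → ℝ => (∑ i, w i • z i, w)) '' stdSimplex ℝ ι := by
    ext ⟨p, w⟩
    simp only [convexPairs, mem_ofPred_eq, mem_image, Prod.mk.injEq]
    exact ⟨fun h => ⟨w, h.1, h.2.symm, rfl⟩, by rintro ⟨w', h, rfl, rfl⟩; exact ⟨h, rfl⟩⟩
  rw [this]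
  exact (isCompact_stdSimplex ℝ ι).image (by fun_prop)

theorem nonempty_convexPairs [Nonempty ι] (z : ι → E) : (convexPairs z).Nonempty := by
  classical
  obtain ⟨i⟩ := ‹Nonempty ι›
  exact ⟨(∑ j, (Pi.single i 1 : ι → ℝ) j • z j, Pi.single i 1), single_mem_stdSimplex ℝ i, rfl⟩

theorem exists_isMinOn_convexPairs [Nonempty ι] (z : ι → E) (v : E) :
    ∃ q ∈ convexPairs z, IsMinOn (fun q => ‖q.1 - v‖) (convexPairs z) q :=
  (isCompact_convexPairs z).exists_isMinOn (nonempty_convexPairs z) (by fun_prop)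

theorem sub_eq_sum_smul_sub {z : ι → E} {v : E} {q : E × (ι → ℝ)} (hq : q ∈ convexPairs z) :
    q.1 - v = ∑ i, q.2 i • (z i - v) := by
  simp_rw [smul_sub, Finset.sum_sub_distrib, ← Finset.sum_smul, hq.1.2, one_smul, hq.2]

/-- First-order optimality: moving the minimizer towards the vertex z i stays in the convex hull and
cannot shorten the vector. -/
theorem sq_norm_le_inner_of_isMinOn {z : ι → E} {v : E} {q : E × (ι → ℝ)}
    (hq : q ∈ convexPairs z) (hmin : IsMinOn (fun q => ‖q.1 - v‖) (convexPairs z) q) (i : ι) :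
    ‖q.1 - v‖ ^ 2 ≤ ⟪z i - v, q.1 - v⟫ := by
  classical
  set m := q.1 - v with hm
  have key : ∀ s : ℝ, 0 < s → s ≤ 1 → ‖m‖ ^ 2 ≤ ‖m + s • ((z i - v) - m)‖ ^ 2 := by
    intro s hs hs1
    have hmem : ((1 - s) • q.1 + s • z i, (1 - s) • q.2 + s • Pi.single i (1 : ℝ)) ∈
        convexPairs z := by
      refine ⟨convex_stdSimplex ℝ ι hq.1 (single_mem_stdSimplex ℝ i) (by linarith) hs.le
        (by ring), ?_⟩
      simp only [Pi.add_apply, Pi.smul_apply, add_smul, Finset.sum_add_distrib, smul_assoc,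
        ← Finset.smul_sum, ← hq.2]
      congr 2
      simp [Pi.single_apply]
    have h := hmin hmem
    simp only [mem_ofPred_eq] at h
    have he : (1 - s) • q.1 + s • z i - v = m + s • ((z i - v) - m) := by
      rw [hm]; module
    rw [he] at h
    exact pow_le_pow_left₀ (norm_nonneg _) h 2
  by_contra! hlt
  set d := (z i - v) - m with hd
  have hin : ⟪m, d⟫ < 0 := by
    rw [hd, inner_sub_right, real_inner_self_eq_norm_sq, real_inner_comm]; linarith
  have hexp : ∀ s : ℝ, ‖m + s • d‖ ^ 2 = ‖m‖ ^ 2 + 2 * s * ⟪m, d⟫ + s ^ 2 * ‖d‖ ^ 2 := fun s => by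
    rw [norm_add_sq_real, real_inner_smul_right, norm_smul, mul_pow, Real.norm_eq_abs, sq_abs]
    ring
  -- This s is small enough that the quadratic term s²‖d‖² stays below half of the negative linear
  -- term.
  set s := min 1 (-⟪m, d⟫ / (‖d‖ ^ 2 + 1)) with hs
  have hs0 : 0 < s := lt_min one_pos (div_pos (by linarith) (by positivity))
  have h := key s hs0 (min_le_left _ _)
  rw [hexp] at h
  have h2 : s * (‖d‖ ^ 2 + 1) ≤ -⟪m, d⟫ := by
    rw [← le_div_iff₀ (by positivity)]; exact min_le_right _ _
  nlinarith [mul_le_mul_of_nonneg_left h2 hs0.le, mul_pos hs0 hs0, mul_pos hs0 (neg_pos.2 hin)]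

end Euclid

/-! ### The deficit -/

/-- This is minimax duality: the best worst-case inner product over unit directions, truncated at 0,
equals the distance to the convex hull. -/
theorem meanDeficit_eq {X : Type*} [MetricSpace X] [HadamardSpace X] {K : CubicalComplex X}
    {C : Set X} {v : EuclideanSpace ℝ (Fin (K.dim C))} (hC : Maximal (fun D => D ∈ K.cells) C)
    (hv : v ∈ interior (unitCube (K.dim C))) {A : Finset X} (hA : A.Nonempty)
    (hvA : K.chart C v ∉ A) {z : A → EuclideanSpace ℝ (Fin (K.dim C))} {τ : A → ℝ}
    (he : ∀ a : A, IsInitialVector K C v (a : X) (z a - v) (τ a))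
    {q : EuclideanSpace ℝ (Fin (K.dim C)) × (A → ℝ)} (hq : q ∈ convexPairs z)
    (hmin : IsMinOn (fun q => ‖q.1 - v‖) (convexPairs z) q) :
    meanDeficit A hA (K.chart C v) = ‖q.1 - v‖ := by
  have hne : ∀ a : A, (a : X) ≠ K.chart C v := fun a h => hvA (h ▸ a.2)
  have hterm : ∀ {y : X} {e : EuclideanSpace ℝ (Fin (K.dim C))} {σ : ℝ},
      IsInitialVector K C v y e σ → y ≠ K.chart C v → ∀ a : A,
      dist (a : X) (K.chart C v) * Real.cos (alexandrovAngle (K.chart C v) a y) =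
        ⟪z a - v, e⟫ / ‖e‖ := by
    intro y e σ h hy a
    have h1 : dist (a : X) (K.chart C v) = ‖z a - v‖ := by
      rw [dist_comm, (he a).norm_eq hC.1]
    have h2 : ‖z a - v‖ ≠ 0 := by rw [← h1]; exact dist_ne_zero.2 (hne a)
    rw [(he a).cos_alexandrovAngle hC.1 h (hne a) hy, h1]
    field_simp
  have hbound : ∀ r ∈ {r : ℝ | ∃ y : X, y ≠ K.chart C v ∧ r = A.inf' hA (fun a =>
      dist a (K.chart C v) * Real.cos (alexandrovAngle (K.chart C v) a y))}, r ≤ ‖q.1 - v‖ := by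
    rintro r ⟨y, hy, rfl⟩
    obtain ⟨e, σ, h⟩ := exists_initialVector hC hv y
    have hepos : 0 < ‖e‖ := by rw [h.norm_eq hC.1]; exact dist_pos.2 hy.symm
    set ρ := A.inf' hA (fun a =>
      dist a (K.chart C v) * Real.cos (alexandrovAngle (K.chart C v) a y)) with hρ
    have h1 : ∀ a : A, ρ * ‖e‖ ≤ ⟪z a - v, e⟫ := fun a => by
      rw [← le_div_iff₀ hepos, ← hterm h hy a]
      exact Finset.inf'_le (fun a =>
        dist a (K.chart C v) * Real.cos (alexandrovAngle (K.chart C v) a y)) a.2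
    have h2 : ρ * ‖e‖ ≤ ⟪q.1 - v, e⟫ := by
      rw [sub_eq_sum_smul_sub hq, sum_inner]
      simp only [real_inner_smul_left]
      calc ρ * ‖e‖ = ∑ a, q.2 a * (ρ * ‖e‖) := by rw [← Finset.sum_mul, hq.1.2, one_mul]
        _ ≤ _ := Finset.sum_le_sum fun a _ => mul_le_mul_of_nonneg_left (h1 a) (hq.1.1 a)
    exact le_of_mul_le_mul_right (h2.trans (real_inner_le_norm _ _)) hepos
  rw [meanDeficit]
  refine le_antisymm (max_le (Real.sSup_le hbound (norm_nonneg _)) (norm_nonneg _)) ?_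
  -- With no direction to test when this vector vanishes, the truncation at 0 gives the bound;
  -- otherwise a point of the cell in that direction serves as y.
  by_cases hm : q.1 - v = 0
  · rw [hm, norm_zero]; exact le_max_right _ _
  have hmpos : 0 < ‖q.1 - v‖ := norm_pos_iff.2 hm
  obtain ⟨δ, hδ, hδmem⟩ := exists_pos_add_smul_mem hv (q.1 - v)
  have hs : (0 : ℝ) < δ / 2 := by positivity
  have hmem := hδmem (δ / 2) hs.le (by linarith)
  have hvec := isInitialVector_of_geoPoint_eq hC.1 (interior_subset hv) one_pos le_rfl hmem
    (geoPoint_one (K.chart C v) (K.chart C (v + (δ / 2) • (q.1 - v)))).symm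
  rw [add_sub_cancel_left, div_one, one_smul] at hvec
  have hyne : K.chart C (v + (δ / 2) • (q.1 - v)) ≠ K.chart C v := by
    rw [← dist_pos, dist_comm, ← hvec.norm_eq hC.1, norm_smul, Real.norm_of_nonneg hs.le]
    positivity
  refine le_max_of_le_left (le_trans ?_ (le_csSup ⟨_, hbound⟩ ⟨_, hyne, rfl⟩))
  refine Finset.le_inf' _ _ fun a ha => ?_
  rw [hterm hvec hyne ⟨a, ha⟩, real_inner_smul_right, norm_smul, Real.norm_of_nonneg hs.le,
    mul_div_mul_left _ _ hs.ne', le_div_iff₀ hmpos, ← sq]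
  exact sq_norm_le_inner_of_isMinOn hq hmin ⟨a, ha⟩

end CubeMean

theorem mainTheorem6 {X : Type*} [MetricSpace X] [CubeMean.HadamardSpace X]
    (K : CubeMean.CubicalComplex X) (A : Finset X) (hA : A.Nonempty)
    (x : X) (hxA : x ∉ A)
    (C : Set X) (hC : Maximal (fun D => D ∈ K.cells) C)
    -- `v` is the position of `x` in the ambient Euclidean space of the cell `C`
    (v : EuclideanSpace ℝ (Fin (K.dim C)))
    (hv : v ∈ interior (CubeMean.unitCube (K.dim C))) (hvx : K.chart C v = x) :
    (∀ a ∈ A, ∃ δ : ℝ, 0 < δ ∧ ∀ t : ℝ, 0 < t → t ≤ 1 → t < δ →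
      CubeMean.geoPoint x a t ∈ C) ∧
    ∀ t : A → ℝ, (∀ a, 0 < t a ∧ t a ≤ 1) →
    -- `u a` is the position of the point `x_a = (1 - t_a) x + t_a a` of `C`
    ∀ u : A → EuclideanSpace ℝ (Fin (K.dim C)),
    (∀ a, u a ∈ CubeMean.unitCube (K.dim C) ∧
      K.chart C (u a) = CubeMean.geoPoint x (a : X) (t a)) →
    ∀ z : A → EuclideanSpace ℝ (Fin (K.dim C)),
    (∀ a, z a = v + (1 / t a) • (u a - v)) →
    IsLeast ((fun q => ‖q.1 - v‖) '' CubeMean.convexPairs z) (CubeMean.meanDeficit A hA x) ∧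
    ∀ (zHat : EuclideanSpace ℝ (Fin (K.dim C))) (wHat : A → ℝ),
      (zHat, wHat) ∈ CubeMean.convexPairs z →
      IsMinOn (fun q => ‖q.1 - v‖) (CubeMean.convexPairs z) (zHat, wHat) →
      (CubeMean.meanDeficit A hA x = 0 →
        x ∈ CubeMean.meanSet A ∧ CubeMean.CertifiesMean A wHat x) ∧
      (0 < CubeMean.meanDeficit A hA x →
        x ∉ CubeMean.meanSet A ∧
        ∃ δ : ℝ, 0 < δ ∧ ∀ s : ℝ, 0 < s → s < δ →
          (1 - s) • v + s • zHat ∈ CubeMean.unitCube (K.dim C) ∧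
          CubeMean.CertifiesNotMean A (K.chart C ((1 - s) • v + s • zHat)) x) := by
  subst hvx
  refine ⟨fun a _ => ?_, fun t ht u hu z hz => ?_⟩
  · obtain ⟨δ, hδ, h⟩ := CubeMean.exists_chart_eq_geoPoint hC hv a
    refine ⟨δ, hδ, fun t h0 h1 h2 => ?_⟩
    obtain ⟨u, hu, hut⟩ := h t h0 h1 h2
    exact hut ▸ K.chart_mem hC.1 hu
  have hvC := interior_subset hv
  have he : ∀ a : A, CubeMean.IsInitialVector K C v (a : X) (z a - v) (t a) := fun a => by
    rw [hz a, add_sub_cancel_left]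
    exact CubeMean.isInitialVector_of_geoPoint_eq hC.1 hvC (ht a).1 (ht a).2 (hu a).1 (hu a).2
  have : Nonempty A := hA.to_subtype
  refine ⟨?_, fun zHat wHat hq hmin => ?_⟩
  · obtain ⟨q, hq, hmin⟩ := CubeMean.exists_isMinOn_convexPairs z v
    rw [CubeMean.meanDeficit_eq hC hv hA hxA he hq hmin]
    exact ⟨Set.mem_image_of_mem _ hq, Set.forall_mem_image.2 fun p hp => hmin hp⟩
  rw [CubeMean.meanDeficit_eq hC hv hA hxA he hq hmin]
  refine ⟨fun h0 => ?_, fun hpos => ?_⟩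
  · have hcert := CubeMean.certifiesMean_of_sum_eq_zero hC.1 he
      (CubeMean.exists_initialVector hC hv) hq.1
      ((CubeMean.sub_eq_sum_smul_sub hq).symm.trans (norm_eq_zero.1 h0))
    exact ⟨⟨wHat, hcert⟩, hcert⟩
  · have hm : zHat - v ≠ 0 := norm_pos_iff.1 hpos
    obtain ⟨δ, hδ, hδmem⟩ := CubeMean.exists_pos_add_smul_mem hv (zHat - v)
    have hcert : ∃ δ : ℝ, 0 < δ ∧ ∀ s : ℝ, 0 < s → s < δ →
        (1 - s) • v + s • zHat ∈ CubeMean.unitCube (K.dim C) ∧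
        CubeMean.CertifiesNotMean A (K.chart C ((1 - s) • v + s • zHat)) (K.chart C v) := by
      -- Below δ the point stays in the cube; below every t a it satisfies the parameter bound of
      -- `dist_lt` for all a.
      refine ⟨min δ (Finset.univ.inf' Finset.univ_nonempty t), lt_min hδ
        ((Finset.lt_inf'_iff _).2 fun a _ => (ht a).1), fun s hs0 hs => ?_⟩
      have heq : (1 - s) • v + s • zHat = v + s • (zHat - v) := by module
      have hmem := hδmem s hs0.le (hs.trans_le (min_le_left _ _))
      rw [heq]
      refine ⟨hmem, fun a ha => ?_⟩
      exact (he ⟨a, ha⟩).dist_lt hC.1 hm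
        (CubeMean.sq_norm_le_inner_of_isMinOn hq hmin ⟨a, ha⟩) hs0
        (hs.trans_le ((min_le_right _ _).trans (Finset.inf'_le t (Finset.mem_univ ⟨a, ha⟩)))) hmem
    obtain ⟨δ', hδ', h⟩ := hcert
    exact ⟨(h (δ' / 2) (by positivity) (by linarith)).2.notMem_meanSet, δ', hδ', h⟩
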